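/- Let $\mathbb{R}_{\max}=\mathbb{R}\cup\{-\infty\}$, and let $A=(a_{ij}),B=(b_{ij})\in\mathbb{R}_{\max}^{m\times n}$, $n\ge 1$, be such that neither $A$ nor $B$ has a row all of whose entries are $-\infty$, and no index $j$ is such that the $j$-th columns of $A$ and of $B$ are both identically $-\infty$. For $x\in\mathbb{R}_{\max}^n$ put $(Ax)_i=\max_j(a_{ij}+x_j)$, and for $y\in\mathbb{R}_{\max}^m$ put $(A^{\sharp}y)_j=\min_i(-a_{ij}+y_i)$ with the convention $(-\infty)+(+\infty)=+\infty$; likewise for $B$. For $\lambda\in\mathbb{R}$ let $$h_\lambda(x)=(\lambda+A^{\sharp}Bx)\wedge(-\lambda+B^{\sharp}Ax),\qquad x\in\mathbb{R}_{\max}^n,$$ where $\wedge$ is the componentwise minimum. The spectral function $s$ of $(A,B)$ is $s(\lambda)=r(h_\lambda)$, where $r(f)$ is the largest $\mu\in\mathbb{R}_{\max}$ such that $f(x)=\mu+x$ for some $x\in\mathbb{R}_{\max}^n$ with at least one component different from $-\infty$. A real number $\sigma$ is called the left (resp. right) asymptotic slope of $s$ if there is $\alpha\in\mathbb{R}$ such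 that $s(\lambda)=\sigma\lambda+\alpha$ for all sufficiently small (resp. sufficiently large) $\lambda\in\mathbb{R}$. Let $A^\circ,B^\circ$ be obtained from $A,B$ by replacing every finite entry by $0$ and keeping the entries $-\infty$, and let $s^\circ$ be the spectral function of $(A^\circ,B^\circ)$. Then $s$ has a left asymptotic slope of the form $k_1/l_1$ and a right asymptotic slope of the form $-k_2/l_2$, with integers $k_1,k_2\ge 0$ and $l_1,l_2>0$; and for all such integers for which these are the left and the right asymptotic slopes of $s$, $$s^\circ(\lambda)=\begin{cases}\lambda k_1/l_1, & \lambda\le 0,\\ -\lambda k_2/l_2, & \lambda\ge 0,\end{cases}$$ where it is part of the claim that the maxima defining these values are attained. -/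

import Mathlib

namespace TwoSidedEig

/-- The max-plus semiring carrier `ℝ ∪ {-∞}`; `⊔` is the max-plus sum and `+` (with `-∞`
absorbing) the max-plus product. -/
abbrev Rmax : Type := WithBot ℝ

/-- `ℝ ∪ {-∞, +∞}`. The addition of `WithTop` obeys the convention `(-∞) + (+∞) = +∞`. -/
abbrev RmaxBar : Type := WithTop Rmax

/-- The sign change `a ↦ -a` on `ℝ ∪ {-∞}`, with `-(-∞) = +∞`. -/
def negBar : Rmax → RmaxBar
  | ⊥ => ⊤
  | (r : ℝ) => ((-r : ℝ) : Rmax)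

/-- The max-plus matrix-vector product `(A x) i = max_j (a i j + x j)`. -/
noncomputable def mulVec {m n : ℕ} (A : Matrix (Fin m) (Fin n) Rmax) (x : Fin n → Rmax) :
    Fin m → Rmax :=
  fun i => Finset.univ.sup fun j => A i j + x j

/-- The residuated operator `(A♯ y) j = min_i (-a i j + y i)`. -/
noncomputable def residuated {m n : ℕ} (A : Matrix (Fin m) (Fin n) Rmax) (y : Fin m → Rmax) :
    Fin n → RmaxBar :=
  fun j => Finset.univ.inf fun i => negBar (A i j) + (y i : RmaxBar)

/-- The min-max function `h_t x = (t + A♯ (B x)) ∧ (-t + B♯ (A x))`. -/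
noncomputable def minMaxFun {m n : ℕ} (A B : Matrix (Fin m) (Fin n) Rmax) (t : ℝ)
    (x : Fin n → Rmax) : Fin n → RmaxBar :=
  fun j => (((t : Rmax) : RmaxBar) + residuated A (mulVec B x) j) ⊓
    (((-t : ℝ) : Rmax) + residuated B (mulVec A x) j)

/-- The eigenvalues `μ ∈ ℝ ∪ {-∞}` of a map `f`: those with `f x = μ + x` for some vector `x`
having at least one component different from `-∞`. -/
def eigenvalues {n : ℕ} (f : (Fin n → Rmax) → Fin n → RmaxBar) : Set Rmax :=
  {μ | ∃ x : Fin n → Rmax, (∃ j, x j ≠ ⊥) ∧ ∀ j, f x j = ((μ + x j : Rmax) : RmaxBar)}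

/-- `s(t) = v`, where `s` is the spectral function of `A x = t + B x`: the spectral radius
(the largest eigenvalue) of `h_t` exists and equals the real number `v`. -/
def SpectralFunctionEq {m n : ℕ} (A B : Matrix (Fin m) (Fin n) Rmax) (t v : ℝ) : Prop :=
  IsGreatest (eigenvalues (minMaxFun A B t)) (v : Rmax)

/-- `σ` is the left asymptotic slope of the spectral function `s` of `(A, B)`:
`s(t) = σ t + α` for all sufficiently small `t`. -/
def IsLeftSlope {m n : ℕ} (A B : Matrix (Fin m) (Fin n) Rmax) (σ : ℝ) : Prop :=
  ∃ α L : ℝ, ∀ t : ℝ, t ≤ L → SpectralFunctionEq A B t (t * σ + α)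

/-- `σ` is the right asymptotic slope of the spectral function `s` of `(A, B)`:
`s(t) = σ t + α` for all sufficiently large `t`. -/
def IsRightSlope {m n : ℕ} (A B : Matrix (Fin m) (Fin n) Rmax) (σ : ℝ) : Prop :=
  ∃ α L : ℝ, ∀ t : ℝ, L ≤ t → SpectralFunctionEq A B t (t * σ + α)

/-- The Boolean pattern `C°` of `C`: finite entries are replaced by `0`, entries `-∞` are kept. -/
def pattern {m n : ℕ} (C : Matrix (Fin m) (Fin n) Rmax) : Matrix (Fin m) (Fin n) Rmax :=
  fun i j => WithBot.map (fun _ : ℝ => (0 : ℝ)) (C i j)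

end TwoSidedEig

namespace TwoSidedEig

open Filter Topology

/-! Residuation turns `h_t` into the min-max map of a deterministic game: the minimizer picks a row
of `A` or `B` finite in the current column, then the maximizer picks a column from the same row of
the other matrix.

Such a map is monotone, commutes with constants, is continuous and preserves finite vectors.
Vanishing-discount limits then yield a real eigenvalue dominating every super-eigenvalue
(`exists_maximal_eigenvalue`). This gives attainment of `s`, and makes `s` inherit comparisons
between maps (`IsMaximalEigenvalue.le_add`).

Every eigenvalue is a mean payment along a cycle, so the graph of `s` lies on finitely many lines
with rational slopes. Since `s` is 1-Lipschitz, it follows a single line near `+∞`; since `s ≤ 0`,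
that slope is nonpositive. Exchanging `A` and `B` reverses `t`, which settles the left side.

For the patterns, `s°` is positively homogeneous, and `s - s°` is bounded because finite entries are
bounded. Hence `s°` on each half-line is determined by the asymptotic slope of `s`. -/

theorem continuous_coe_add_Rmax (c : ℝ) : Continuous fun x : Rmax => (c : Rmax) + x := by
  refine continuous_iff_continuousAt.2 fun x => ?_
  induction x using WithBot.recBotCoe with
  | bot =>
    simp only [ContinuousAt, WithBot.add_bot]
    refine (WithBot.tendsto_nhds_bot_iff _).2 fun r => ?_
    filter_upwards [Iio_mem_nhds (WithBot.bot_lt_coe (r - c))] with y hy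
    induction y using WithBot.recBotCoe with
    | bot => simp
    | coe y =>
      have : y < r - c := WithBot.coe_lt_coe.1 hy
      exact_mod_cast (by linarith : c + y < r)
  | coe x =>
    simp only [ContinuousAt, WithBot.nhds_coe, tendsto_map'_iff]
    rw [← WithBot.coe_add, WithBot.nhds_coe]
    exact tendsto_map.comp ((continuous_const.add continuous_id).tendsto x)

/-- If `a u → w` with `a → 1` and `u ≤ 0`, then also `v + u → v₀ + w` when `v → v₀`. -/
theorem tendsto_coe_add_of_tendsto_mul {β : Type*} {F : Filter β} {a u v : β → ℝ} {v₀ : ℝ}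
    {w : Rmax} (ha : Tendsto a F (𝓝 1)) (ha1 : ∀ᶠ b in F, a b ≤ 1) (hu : ∀ᶠ b in F, u b ≤ 0)
    (hv : Tendsto v F (𝓝 v₀)) (hw : Tendsto (fun b => ((a b * u b : ℝ) : Rmax)) F (𝓝 w)) :
    Tendsto (fun b => ((v b + u b : ℝ) : Rmax)) F (𝓝 (v₀ + w)) := by
  induction w using WithBot.recBotCoe with
  | bot =>
    rw [WithBot.add_bot]
    refine (WithBot.tendsto_nhds_bot_iff _).2 fun r => ?_
    filter_upwards [(WithBot.tendsto_nhds_bot_iff _).1 hw (r - v₀ - 1), ha1, hu,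
      hv.eventually_lt_const (lt_add_one v₀)] with b h1 h2 h3 h4
    have h1 : a b * u b < r - v₀ - 1 := WithBot.coe_lt_coe.1 h1
    exact WithBot.coe_lt_coe.2 (by nlinarith)
  | coe w =>
    rw [← WithBot.coe_add]
    refine (WithBot.continuous_coe.tendsto _).comp (hv.add ?_)
    have hw' : Tendsto (fun b => a b * u b) F (𝓝 w) :=
      (WithBot.isEmbedding_coe.tendsto_nhds_iff).2 hw
    have h := hw'.div ha one_ne_zero
    rw [div_one] at h
    refine h.congr' ?_
    filter_upwards [ha.eventually_ne one_ne_zero] with b hb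
    simp [hb]

/-- `μ` is an eigenvalue of `g` that dominates every real number `ν` for which there is a
nontrivial vector `z` with `ν + z ≤ g z`. -/
def IsMaximalEigenvalue {ι : Type*} (g : (ι → Rmax) → ι → Rmax) (μ : ℝ) : Prop :=
  (∃ x : ι → Rmax, (∃ j, x j ≠ ⊥) ∧ ∀ j, g x j = μ + x j) ∧
    ∀ (ν : ℝ) (z : ι → Rmax), (∃ j, z j ≠ ⊥) → (∀ j, ν + z j ≤ g z j) → ν ≤ μ

/-! ### Maximal eigenvalues by vanishing discount -/

section Spectral

variable {ι : Type*} [Fintype ι] {g : (ι → Rmax) → ι → Rmax}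
  {f : (ι → ℝ) → ι → ℝ}

/-- Monotonicity and homogeneity make `f` sup-norm nonexpansive, so `x ↦ f (α x)` is an
`α`-contraction. -/
theorem exists_discounted_fixedPoint (hmono : Monotone g)
    (hadd : ∀ (c : ℝ) x, g (fun j => c + x j) = fun j => c + g x j)
    (hf : ∀ x : ι → ℝ, g (fun j => (x j : Rmax)) = fun j => (f x j : Rmax))
    {α : ℝ} (h0 : 0 ≤ α) (h1 : α < 1) : ∃ x : ι → ℝ, f (fun j => α * x j) = x := by
  have key : ∀ x y : ι → ℝ, ∀ j, f (fun j => α * x j) j ≤ α * dist x y + f (fun j => α * y j) j := by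
    intro x y j
    have h := hmono (show (fun j => ((α * x j : ℝ) : Rmax)) ≤
        fun j => ((α * dist x y : ℝ) : Rmax) + ((α * y j : ℝ) : Rmax) from fun j => by
      have := (abs_le.1 ((Real.dist_eq _ _).symm.le.trans (dist_le_pi_dist x y j))).2
      beta_reduce
      exact_mod_cast (by nlinarith : α * x j ≤ α * dist x y + α * y j)) j
    rw [hadd, hf, hf] at h
    beta_reduce at h
    exact_mod_cast h
  have hc : ContractingWith ⟨α, h0⟩ fun x : ι → ℝ => f (fun j => α * x j) := by
    refine ⟨by exact_mod_cast h1, LipschitzWith.of_dist_le_mul fun x y => ?_⟩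
    have hd : (0 : ℝ) ≤ α * dist x y := mul_nonneg h0 dist_nonneg
    refine (dist_pi_le_iff hd).2 fun j => ?_
    rw [Real.dist_eq, abs_le]
    have h1 := key x y j
    have h2 := key y x j
    rw [dist_comm] at h2
    constructor <;> linarith
  exact ⟨_, hc.fixedPoint_isFixedPt⟩

/-- A maximum principle: if `D` is the largest gap between `c + z` and `x` on the support of `z`,
applying `g` gives `D ≤ α D`, hence `D ≤ 0`. -/
theorem super_eigenvector_le_discounted (hmono : Monotone g)
    (hadd : ∀ (c : ℝ) x, g (fun j => c + x j) = fun j => c + g x j)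
    (hf : ∀ x : ι → ℝ, g (fun j => (x j : Rmax)) = fun j => (f x j : Rmax))
    {α : ℝ} (h0 : 0 ≤ α) (h1 : α < 1) {x : ι → ℝ} (hx : f (fun j => α * x j) = x)
    {ν : ℝ} {z : ι → Rmax} (hz0 : ∀ j, z j ≤ 0) (hz : ∀ j, ν + z j ≤ g z j) {i : ι}
    (hi : z i = 0) : ν ≤ (1 - α) * x i := by
  classical
  -- Chosen so that `α c + ν = c`.
  set c : ℝ := ν / (1 - α) with hc
  have hcν : ν = (1 - α) * c := by rw [hc]; field_simp [(sub_pos.2 h1).ne']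
  obtain ⟨j, hj, hmax⟩ := Finset.exists_max_image (Finset.univ.filter fun j => z j ≠ ⊥)
    (fun j => c + (z j).unbotD 0 - x j) ⟨i, by simp [hi]⟩
  set D := c + (z j).unbotD 0 - x j with hD
  -- The sign `z ≤ 0` enters here, through `z k ≤ α z k`.
  have hle : (fun k => ((α * c : ℝ) : Rmax) + z k) ≤
      fun k => ((α * D : ℝ) : Rmax) + ((α * x k : ℝ) : Rmax) := by
    intro k
    by_cases hk : z k = ⊥
    · simp [hk]
    have hm := hmax k (by simp [hk])
    have hk0 := hz0 k
    obtain ⟨r, hr⟩ := WithBot.ne_bot_iff_exists.1 hk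
    simp only [← hr, WithBot.unbotD_coe] at hm hk0 ⊢
    have hk0 : r ≤ 0 := by exact_mod_cast hk0
    have : α * c + r ≤ α * D + α * x k := by nlinarith
    exact_mod_cast this
  have h := hmono hle j
  rw [hadd, hadd, hf, hx] at h
  have h' := (add_le_add_right (hz j) ((α * c : ℝ) : Rmax)).trans h
  obtain ⟨r, hr⟩ := WithBot.ne_bot_iff_exists.1 (Finset.mem_filter.1 hj).2
  rw [← hr] at h' hD
  beta_reduce at h'
  have h' : α * c + (ν + r) ≤ α * D + x j := by exact_mod_cast h'
  rw [WithBot.unbotD_coe] at hD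
  have hD0 : D ≤ 0 := by
    by_contra hcon
    nlinarith
  have hm := hmax i (by simp [hi])
  rw [hi, show ((0 : Rmax)).unbotD 0 = 0 from rfl] at hm
  rw [hcν]
  exact mul_le_mul_of_nonneg_left (by linarith) (by linarith)

/-- A monotone, additively homogeneous, continuous self-map of `(ℝ ∪ {-∞})^ι` which preserves
finite vectors has a real maximal eigenvalue. -/
theorem exists_maximal_eigenvalue [Nonempty ι] (hmono : Monotone g)
    (hadd : ∀ (c : ℝ) x, g (fun j => c + x j) = fun j => c + g x j) (hcont : Continuous g)
    (hf : ∀ x : ι → ℝ, g (fun j => (x j : Rmax)) = fun j => (f x j : Rmax)) :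
    ∃ μ : ℝ, IsMaximalEigenvalue g μ := by
  classical
  obtain ⟨X, hX⟩ : ∃ X : ℝ → ι → ℝ, ∀ α, 0 ≤ α → α < 1 → f (fun j => α * X α j) = X α := by
    choose! X hX using fun α (h : 0 ≤ α ∧ α < 1) =>
      exists_discounted_fixedPoint hmono hadd hf h.1 h.2
    exact ⟨X, fun α h h' => hX α ⟨h, h'⟩⟩
  choose J hJ using fun α => Finite.exists_max (X α)
  obtain ⟨C, hC⟩ : ∃ C : ℝ, ∀ j, |f 0 j| ≤ C := by
    obtain ⟨j, hj⟩ := Finite.exists_max fun j => |f 0 j|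
    exact ⟨_, hj⟩
  have hlow : ∀ α, 0 ≤ α → α < 1 → ∀ (ν : ℝ) (z : ι → Rmax), (∀ j, z j ≤ 0) →
      (∃ j, z j = 0) → (∀ j, ν + z j ≤ g z j) → ν ≤ (1 - α) * X α (J α) := by
    rintro α h0 h1 ν z hz0 ⟨i, hi⟩ hz
    exact (super_eigenvector_le_discounted hmono hadd hf h0 h1 (hX α h0 h1) hz0 hz hi).trans
      (mul_le_mul_of_nonneg_left (hJ α i) (by linarith))
  have hg0 : g (fun _ => 0) = fun j => ((f 0 j : ℝ) : Rmax) := hf 0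
  have hbound : ∀ α, 0 ≤ α → α < 1 → (1 - α) * X α (J α) ∈ Set.Icc (-C) C := by
    intro α h0 h1
    constructor
    · refine hlow α h0 h1 (-C) (fun _ => 0) (fun _ => le_rfl) ⟨Classical.arbitrary ι, rfl⟩ ?_
      intro j
      rw [hg0, add_zero]
      exact WithBot.coe_le_coe.2 (abs_le.1 (hC j)).1
    · have h := hmono (show (fun j => ((α * X α j : ℝ) : Rmax)) ≤
          fun _ => ((α * X α (J α) : ℝ) : Rmax) + 0 from fun j => by
        rw [add_zero]
        exact WithBot.coe_le_coe.2 (mul_le_mul_of_nonneg_left (hJ α j) h0)) (J α)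
      rw [hadd, hf, hX α h0 h1, hg0] at h
      beta_reduce at h
      have h : X α (J α) ≤ α * X α (J α) + f 0 (J α) := by exact_mod_cast h
      have := (abs_le.1 (hC (J α))).2
      linarith
  -- Along an ultrafilter, compactness gives limits of eigenvalue and vector without extracting
  -- subsequences.
  let U : Ultrafilter ℝ := Ultrafilter.of (𝓝[<] (1 : ℝ))
  have hU : (U : Filter ℝ) ≤ 𝓝[<] (1 : ℝ) := Ultrafilter.of_le _
  have hU1 : ∀ᶠ α in (U : Filter ℝ), α < 1 := hU self_mem_nhdsWithin
  have hUt : Tendsto (fun α : ℝ => α) (U : Filter ℝ) (𝓝 1) := hU.trans nhdsWithin_le_nhds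
  have hU0 : ∀ᶠ α in (U : Filter ℝ), 0 < α := hUt.eventually_const_lt one_pos
  obtain ⟨μ, -, hμ⟩ : ∃ μ ∈ Set.Icc (-C) C,
      Tendsto (fun α => (1 - α) * X α (J α)) (U : Filter ℝ) (𝓝 μ) :=
    isCompact_Icc.ultrafilter_le_nhds' (U.map fun α => (1 - α) * X α (J α)) (by
      rw [Ultrafilter.mem_map]
      filter_upwards [hU1, hU0] with α h1 h0 using hbound α h0.le h1)
  -- The factor `α` lets the fixed-point equation evaluate `g (W α)`. The top coordinate is `0`, so
  -- the limit, whose entries may be `-∞`, is still nontrivial.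
  let W : ℝ → ι → Rmax := fun α j => ((α * (X α j - X α (J α)) : ℝ) : Rmax)
  have hK : IsCompact (⋃ i : ι, Set.pi Set.univ (fun _ : ι => Set.Icc (⊥ : Rmax) 0) ∩
      {w : ι → Rmax | w i = 0}) :=
    isCompact_iUnion fun i => (isCompact_univ_pi fun _ => isCompact_Icc).inter_right
      (isClosed_eq (continuous_apply i) continuous_const)
  obtain ⟨w, hw, hWw⟩ : ∃ w ∈ ⋃ i : ι, Set.pi Set.univ (fun _ : ι => Set.Icc (⊥ : Rmax) 0) ∩
      {w : ι → Rmax | w i = 0}, Tendsto W (U : Filter ℝ) (𝓝 w) :=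
    hK.ultrafilter_le_nhds' (U.map W) (by
      rw [Ultrafilter.mem_map]
      filter_upwards [hU0] with α h0
      refine Set.mem_iUnion.2 ⟨J α, fun j _ => ⟨bot_le, ?_⟩, ?_⟩
      · exact WithBot.coe_le_coe.2 <| mul_nonpos_of_nonneg_of_nonpos h0.le (sub_nonpos.2 (hJ α j))
      · simp [W])
  obtain ⟨i, -, hi⟩ := Set.mem_iUnion.1 hw
  refine ⟨μ, ⟨w, ⟨i, by rw [show w i = 0 from hi]; exact WithBot.coe_ne_bot⟩, fun j => ?_⟩, ?_⟩
  · have h1 : Tendsto (fun α => g (W α) j) (U : Filter ℝ) (𝓝 (g w j)) :=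
      ((continuous_apply j).tendsto _).comp ((hcont.tendsto w).comp hWw)
    have h2 := tendsto_coe_add_of_tendsto_mul (u := fun α => X α j - X α (J α)) hUt
      (hU1.mono fun _ h => h.le) (Eventually.of_forall fun α => sub_nonpos.2 (hJ α j)) hμ
      (((continuous_apply j).tendsto _).comp hWw)
    refine tendsto_nhds_unique (h1.congr' ?_) h2
    filter_upwards [hU1, hU0] with α h1 h0
    have : W α = fun k => ((-(α * X α (J α)) : ℝ) : Rmax) + ((α * X α k : ℝ) : Rmax) := by
      funext k
      rw [← WithBot.coe_add]
      exact WithBot.coe_inj.2 (by ring)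
    rw [this, hadd, hf, hX α h0.le h1]
    beta_reduce
    rw [← WithBot.coe_add]
    exact WithBot.coe_inj.2 (by ring)
  · rintro ν z ⟨k, hk⟩ hz
    obtain ⟨j, hj⟩ := Finite.exists_max z
    obtain ⟨a, ha⟩ := WithBot.ne_bot_iff_exists.1 (ne_bot_of_le_ne_bot hk (hj k))
    refine ge_of_tendsto hμ ?_
    filter_upwards [hU1, hU0] with α h1 h0
    refine hlow α h0.le h1 ν (fun k => ((-a : ℝ) : Rmax) + z k) ?_ ⟨j, ?_⟩ ?_
    · intro k
      refine (add_le_add_right (hj k) _).trans ?_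
      rw [← ha, ← WithBot.coe_add, neg_add_cancel, WithBot.coe_zero]
    · rw [← ha, ← WithBot.coe_add, neg_add_cancel, WithBot.coe_zero]
    · intro k
      rw [hadd, add_left_comm]
      exact add_le_add_right (hz k) _

end Spectral

/-- An eigenvector of `g` for `μ` is a super-eigenvector of `g'` for `μ - D`. -/
theorem IsMaximalEigenvalue.le_add {ι : Type*} {g g' : (ι → Rmax) → ι → Rmax} {μ μ' D : ℝ}
    (h : IsMaximalEigenvalue g μ) (h' : IsMaximalEigenvalue g' μ')
    (hg : ∀ x j, g x j ≤ D + g' x j) : μ ≤ D + μ' := by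
  obtain ⟨x, hx, hgx⟩ := h.1
  have := h'.2 (μ - D) x hx fun j => by
    have hj := hg x j
    rw [hgx] at hj
    have := add_le_add_right hj ((-D : ℝ) : Rmax)
    rwa [← add_assoc, ← add_assoc, ← WithBot.coe_add, ← WithBot.coe_add, neg_add_cancel,
      WithBot.coe_zero, zero_add, neg_add_eq_sub] at this
  linarith

/-! ### Min-max maps of deterministic games -/

section Game

variable {ι κ : Type*} [Fintype ι] {P : ι → Finset κ}

/-- The min-max function of a deterministic game: at `j` the minimizer picks `p ∈ P j` and pays
`c j p`, then the maximizer picks `k` and receives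
`M p k` and moves to `k`. -/
noncomputable def gameMap (hP : ∀ j, (P j).Nonempty) (c : ι → κ → ℝ) (M : κ → ι → Rmax)
    (x : ι → Rmax) (j : ι) : Rmax :=
  (P j).inf' (hP j) fun p => (c j p : Rmax) + Finset.univ.sup fun k => M p k + x k

variable {hP : ∀ j, (P j).Nonempty} {c : ι → κ → ℝ} {M : κ → ι → Rmax}

theorem gameMap_monotone : Monotone (gameMap hP c M) := fun _ _ h _ =>
  Finset.inf'_mono_fun fun p _ => add_le_add_right
    (Finset.sup_mono_fun fun k _ => add_le_add_right (h k) (M p k)) _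

theorem exists_gameMap_eq_add_sup (x : ι → Rmax) (j : ι) :
    ∃ p ∈ P j, gameMap hP c M x j = c j p + Finset.univ.sup fun k => M p k + x k :=
  Finset.exists_mem_eq_inf' (hP j) _

theorem gameMap_le {x : ι → Rmax} {j : ι} {p : κ} (hp : p ∈ P j) :
    gameMap hP c M x j ≤ c j p + Finset.univ.sup fun k => M p k + x k :=
  Finset.inf'_le _ hp

theorem sup_le_add_sup [Nonempty ι] {y y' : ι → Rmax} {a b : Rmax}
    (h : ∀ k, a + y k ≤ b + y' k) :
    a + Finset.univ.sup y ≤ b + Finset.univ.sup y' := by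
  obtain ⟨k, -, hk⟩ := Finset.exists_mem_eq_sup Finset.univ Finset.univ_nonempty y
  rw [hk]
  exact (h k).trans (add_le_add_right (Finset.le_sup (Finset.mem_univ k)) _)

theorem gameMap_le_add_gameMap [Nonempty ι] {P' : ι → Finset κ} {hP' : ∀ j, (P' j).Nonempty}
    {c' : ι → κ → ℝ} {M' : κ → ι → Rmax} {D : ℝ} (hPP : ∀ j, P' j ⊆ P j)
    (h : ∀ j, ∀ p ∈ P' j, ∀ k, (c j p : Rmax) + M p k ≤ D + (c' j p + M' p k))
    (x : ι → Rmax) (j : ι) : gameMap hP c M x j ≤ D + gameMap hP' c' M' x j := by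
  obtain ⟨p, hp, hpe⟩ := exists_gameMap_eq_add_sup (hP := hP') (c := c') (M := M') x j
  rw [hpe, ← add_assoc]
  refine (gameMap_le (hPP j hp)).trans (sup_le_add_sup fun k => ?_)
  rw [← add_assoc, ← add_assoc, add_assoc (D : Rmax)]
  exact add_le_add_left (h j p hp k) _

theorem gameMap_coe_add [Nonempty ι] (b : ℝ) (x : ι → Rmax) :
    gameMap hP c M (fun j => b + x j) = fun j => b + gameMap hP c M x j := by
  have key : ∀ p, (Finset.univ.sup fun k => M p k + (b + x k)) =
      b + Finset.univ.sup fun k => M p k + x k := by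
    intro p
    apply le_antisymm
    · have := sup_le_add_sup (a := 0) (b := (b : Rmax)) (y := fun k => M p k + (b + x k))
        (y' := fun k => M p k + x k) fun k => by rw [zero_add, add_left_comm]
      rwa [zero_add] at this
    · have := sup_le_add_sup (a := (b : Rmax)) (b := 0) (y := fun k => M p k + x k)
        (y' := fun k => M p k + (b + x k)) fun k => by rw [zero_add, add_left_comm]
      rwa [zero_add] at this
  funext j
  simp only [gameMap, key]
  exact (Finset.apply_inf'_eq_inf'_comp (hP j) (fun y : Rmax => (b : Rmax) + y)
    (fun y y' => (add_right_mono (a := (b : Rmax))).map_inf y y') |>.trans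
      (Finset.inf'_congr _ rfl fun p _ => add_left_comm _ _ _)).symm

theorem continuous_gameMap : Continuous (gameMap hP c M) := by
  refine continuous_pi fun j => Continuous.finset_inf'_apply _ fun p _ =>
    (continuous_coe_add_Rmax _).comp (Continuous.finset_sup_apply fun k _ => ?_)
  induction h : M p k using WithBot.recBotCoe with
  | bot => simpa using continuous_const
  | coe r => exact (continuous_coe_add_Rmax r).comp (continuous_apply k)

theorem gameMap_ne_bot (hM : ∀ p, ∃ k, M p k ≠ ⊥) {x : ι → Rmax} (hx : ∀ j, x j ≠ ⊥) (j : ι) :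
    gameMap hP c M x j ≠ ⊥ := by
  obtain ⟨p, -, h⟩ := exists_gameMap_eq_add_sup (hP := hP) (c := c) (M := M) x j
  obtain ⟨k, hk⟩ := hM p
  rw [h]
  exact WithBot.add_ne_bot.2 ⟨WithBot.coe_ne_bot, ne_bot_of_le_ne_bot
    (WithBot.add_ne_bot.2 ⟨hk, hx k⟩) (Finset.le_sup (f := fun k => M p k + x k)
      (Finset.mem_univ k))⟩

theorem exists_isMaximalEigenvalue_gameMap [Nonempty ι] (hM : ∀ p, ∃ k, M p k ≠ ⊥) :
    ∃ μ : ℝ, IsMaximalEigenvalue (gameMap hP c M) μ := by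
  choose f hf using fun (x : ι → ℝ) j => WithBot.ne_bot_iff_exists.1
    (gameMap_ne_bot (hP := hP) (c := c) hM (x := fun j => (x j : Rmax))
      (fun _ => WithBot.coe_ne_bot) j)
  exact exists_maximal_eigenvalue gameMap_monotone gameMap_coe_add continuous_gameMap
    (f := f) fun x => funext fun j => (hf x j).symm

open Function in
-- By finiteness an orbit of `φ` reaches a cycle, around which the differences of `v` telescope to
-- zero.
theorem exists_minimalPeriod_mul_eq_sum {S : Set ι} (hS : S.Nonempty) {φ : ι → ι}
    (hφ : ∀ j ∈ S, φ j ∈ S) {v W : ι → ℝ} {μ : ℝ} (h : ∀ j ∈ S, μ + v j = W j + v (φ j)) :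
    ∃ j, 0 < minimalPeriod φ j ∧
      minimalPeriod φ j * μ = ∑ r ∈ Finset.range (minimalPeriod φ j), W (φ^[r] j) := by
  obtain ⟨i, hi⟩ := hS
  have hit : ∀ r, φ^[r] i ∈ S := fun r => by
    induction r with
    | zero => exact hi
    | succ r ih => rw [iterate_succ_apply']; exact hφ _ ih
  obtain ⟨a, b, hab, he⟩ := Finite.exists_ne_map_eq_of_infinite fun r : ℕ => φ^[r] i
  wlog hlt : a < b generalizing a b
  · exact this b a hab.symm he.symm (lt_of_le_of_ne (not_lt.1 hlt) hab.symm)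
  have hper : IsPeriodicPt φ (b - a) (φ^[a] i) := by
    rw [IsPeriodicPt, IsFixedPt, ← iterate_add_apply, Nat.sub_add_cancel hlt.le]
    exact he.symm
  refine ⟨φ^[a] i, hper.minimalPeriod_pos (Nat.sub_pos_of_lt hlt), ?_⟩
  have hW : ∀ r, W (φ^[r] (φ^[a] i)) =
      μ + (v (φ^[r] (φ^[a] i)) - v (φ^[r + 1] (φ^[a] i))) := fun r => by
    have := h _ (hit (r + a))
    rw [iterate_add_apply] at this
    rw [iterate_succ_apply']
    linarith
  simp only [hW]
  rw [Finset.sum_add_distrib, Finset.sum_range_sub' fun r => v (φ^[r] (φ^[a] i)),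
    iterate_minimalPeriod]
  simp

open Function in
/-- If the payments depend affinely on `t` with integer slopes, the eigenvalues belong to finitely
many affine functions of `t` with rational slopes. -/
theorem exists_finset_eigenvalue_eq [Finite κ] [Nonempty ι] (hP : ∀ j, (P j).Nonempty)
    (e : κ → ℤ) (c : ι → κ → ℝ) (M : κ → ι → Rmax) :
    ∃ F : Finset (ℝ × ℝ), (∀ q ∈ F, ∃ (p : ℤ) (l : ℕ), 0 < l ∧ q.1 = p / l) ∧
      ∀ (t μ : ℝ) (x : ι → Rmax), (∃ j, x j ≠ ⊥) →
        (∀ j, gameMap hP (fun j p => e p * t + c j p) M x j = μ + x j) →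
          ∃ q ∈ F, μ = t * q.1 + q.2 := by
  classical
  have := Fintype.ofFinite κ
  let φ : (ι → κ × ι) → ι → ι := fun θ j => (θ j).2
  let l : (ι → κ × ι) → ι → ℕ := fun θ j => minimalPeriod (φ θ) j
  -- Mean payment on the cycle through a state, for a stationary choice `θ` of both players. The
  -- default `0` for `-∞` entries only adds harmless lines.
  let line : (ι → κ × ι) × ι → ℝ × ℝ := fun θ =>
    ((∑ r ∈ Finset.range (l θ.1 θ.2), e (θ.1 ((φ θ.1)^[r] θ.2)).1 : ℤ) / (l θ.1 θ.2 : ℝ),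
      (∑ r ∈ Finset.range (l θ.1 θ.2), (c ((φ θ.1)^[r] θ.2) (θ.1 ((φ θ.1)^[r] θ.2)).1 +
        (M (θ.1 ((φ θ.1)^[r] θ.2)).1 (θ.1 ((φ θ.1)^[r] θ.2)).2).unbotD 0)) / (l θ.1 θ.2 : ℝ))
  refine ⟨(Finset.univ.filter fun θ => 0 < l θ.1 θ.2).image line, ?_, ?_⟩
  · simp only [Finset.mem_image, Finset.mem_filter, Finset.mem_univ, true_and]
    rintro _ ⟨θ, hθ, rfl⟩
    exact ⟨_, _, hθ, rfl⟩
  intro t μ x hx hμ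
  have hstep : ∀ j, x j ≠ ⊥ → ∃ θ : κ × ι, x θ.2 ≠ ⊥ ∧ μ + (x j).unbotD 0 =
      (e θ.1 * t + (c j θ.1 + (M θ.1 θ.2).unbotD 0)) + (x θ.2).unbotD 0 := by
    intro j hj
    obtain ⟨p, -, h⟩ := exists_gameMap_eq_add_sup (hP := hP)
      (c := fun j p => e p * t + c j p) (M := M) x j
    obtain ⟨k, -, hk⟩ := Finset.exists_mem_eq_sup Finset.univ Finset.univ_nonempty
      fun k => M p k + x k
    rw [hμ, hk] at h
    obtain ⟨a, ha⟩ := WithBot.ne_bot_iff_exists.1 hj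
    have hne : M p k + x k ≠ ⊥ := by
      intro hb
      rw [hb, WithBot.add_bot, ← ha] at h
      exact WithBot.coe_ne_bot h
    obtain ⟨hM, hxk⟩ := WithBot.add_ne_bot.1 hne
    refine ⟨(p, k), hxk, ?_⟩
    obtain ⟨b, hb⟩ := WithBot.ne_bot_iff_exists.1 hM
    obtain ⟨d, hd⟩ := WithBot.ne_bot_iff_exists.1 hxk
    simp only [← ha, ← hb, ← hd, WithBot.unbotD_coe] at h ⊢
    have h : μ + a = e p * t + c j p + (b + d) := by exact_mod_cast h
    linarith
  have : Nonempty (κ × ι) := let ⟨j, hj⟩ := hx; ⟨(hstep j hj).choose⟩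
  choose! θ hθ1 hθ2 using hstep
  obtain ⟨j, hj, hsum⟩ := exists_minimalPeriod_mul_eq_sum (S := {j | x j ≠ ⊥}) hx (φ := φ θ)
    (v := fun j => (x j).unbotD 0) (μ := μ)
    (W := fun j => e (θ j).1 * t + (c j (θ j).1 + (M (θ j).1 (θ j).2).unbotD 0)) hθ1 hθ2
  refine ⟨line (θ, j), Finset.mem_image_of_mem _ (by simpa [l] using hj), ?_⟩
  have hl : (l θ j : ℝ) ≠ 0 := by exact_mod_cast hj.ne'
  rw [Finset.sum_add_distrib, ← Finset.sum_mul] at hsum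
  simp only [line]
  push_cast
  field_simp
  rw [mul_comm]
  refine hsum.trans ?_
  ring

end Game

/-- A continuous function whose graph lies in a finite union of lines is eventually affine. -/
theorem exists_eventually_eq_line {s : ℝ → ℝ} (hs : Continuous s) {F : Finset (ℝ × ℝ)}
    (hF : ∀ t, ∃ q ∈ F, s t = t * q.1 + q.2) :
    ∃ q ∈ F, ∃ L : ℝ, ∀ t, L ≤ t → s t = t * q.1 + q.2 := by
  classical
  -- Beyond `L` distinct lines no longer meet, so switching lines would disconnect `[L, ∞)`.
  obtain ⟨L, hL⟩ : ∃ L : ℝ, ∀ q ∈ F, ∀ q' ∈ F, q ≠ q' → ∀ t, L ≤ t →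
      t * q.1 + q.2 ≠ t * q'.1 + q'.2 := by
    have : ∀ q q' : ℝ × ℝ, q ≠ q' → ∀ᶠ t : ℝ in atTop, t * q.1 + q.2 ≠ t * q'.1 + q'.2 := by
      intro q q' hq
      filter_upwards [eventually_gt_atTop ((q'.2 - q.2) / (q.1 - q'.1))] with t ht he
      have h1 : q.1 ≠ q'.1 := fun h => hq (Prod.ext h (by rw [h] at he; linarith))
      have h2 : q.1 - q'.1 ≠ 0 := sub_ne_zero.2 h1
      refine ht.ne' ?_
      rw [eq_div_iff h2]
      linarith
    have hev : ∀ᶠ t : ℝ in atTop, ∀ q ∈ F, ∀ q' ∈ F, q ≠ q' →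
        t * q.1 + q.2 ≠ t * q'.1 + q'.2 :=
      F.eventually_all.2 fun q _ => F.eventually_all.2 fun q' _ =>
        eventually_imp_distrib_left.2 (this q q')
    obtain ⟨L, hL⟩ := eventually_atTop.1 hev
    exact ⟨L, fun q hq q' hq' hne t ht => hL t ht q hq q' hq' hne⟩
  obtain ⟨q, hq, hqL⟩ := hF L
  refine ⟨q, hq, L, ?_⟩
  have hcl : ∀ r : ℝ × ℝ, IsClosed {t : ℝ | s t = t * r.1 + r.2} := fun r =>
    isClosed_eq hs (by fun_prop)
  have hpre := isPreconnected_closed_iff.1 (isPreconnected_Ici (a := L))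
    {t | s t = t * q.1 + q.2} (⋃ r ∈ F.erase q, {t | s t = t * r.1 + r.2}) (hcl q)
    ((F.erase q).finite_toSet.isClosed_biUnion fun r _ => hcl r) (fun t _ => by
      obtain ⟨r, hr, h⟩ := hF t
      by_cases hrq : r = q
      · exact Or.inl (hrq ▸ h)
      · exact Or.inr (Set.mem_biUnion (Finset.mem_coe.2 (Finset.mem_erase.2 ⟨hrq, hr⟩)) h))
    ⟨L, Set.self_mem_Ici, hqL⟩
  intro t ht
  obtain ⟨r, hr, h⟩ := hF t
  by_cases hrq : r = q
  · exact hrq ▸ h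
  obtain ⟨u, hu, hu1, hu2⟩ := hpre
    ⟨t, ht, Set.mem_biUnion (Finset.mem_coe.2 (Finset.mem_erase.2 ⟨hrq, hr⟩)) h⟩
  obtain ⟨r', hr', h'⟩ := Set.mem_iUnion₂.1 hu2
  obtain ⟨hne, hr'⟩ := Finset.mem_erase.1 hr'
  exact absurd ((show s u = _ from hu1).symm.trans h') (hL q hq r' hr' hne.symm u hu)

/-! ### The spectral function of a pair of matrices -/

section TwoMatrices

variable {m n : ℕ}

/-- The rows of `A`, tagged `true`, together with the rows of `B`, tagged `false`. -/
def taggedRows (A B : Matrix (Fin m) (Fin n) Rmax) (p : Fin m × Bool) : Fin n → Rmax :=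
  bif p.2 then A p.1 else B p.1

/-- The tagged rows with a finite entry in column `j`. -/
noncomputable def columnSupport (A B : Matrix (Fin m) (Fin n) Rmax) (j : Fin n) :
    Finset (Fin m × Bool) :=
  open Classical in Finset.univ.filter fun p => taggedRows A B p j ≠ ⊥

/-- The sign with which the parameter `t` enters the payment attached to a tagged row. -/
def tagSign (p : Fin m × Bool) : ℤ := bif p.2 then 1 else -1

variable {A B : Matrix (Fin m) (Fin n) Rmax}

theorem mem_columnSupport {j : Fin n} {p : Fin m × Bool} :
    p ∈ columnSupport A B j ↔ taggedRows A B p j ≠ ⊥ := by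
  simp [columnSupport]

theorem columnSupport_nonempty (hAB : ∀ j, ∃ i, A i j ≠ ⊥ ∨ B i j ≠ ⊥) (j : Fin n) :
    (columnSupport A B j).Nonempty := by
  obtain ⟨i, h | h⟩ := hAB j
  · exact ⟨(i, true), mem_columnSupport.2 h⟩
  · exact ⟨(i, false), mem_columnSupport.2 h⟩

/-- The min-max function `h_t` of `(A, B)` as the min-max function of a game. -/
noncomputable def pairGame (hAB : ∀ j, ∃ i, A i j ≠ ⊥ ∨ B i j ≠ ⊥) (t : ℝ) :
    (Fin n → Rmax) → Fin n → Rmax :=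
  gameMap (columnSupport_nonempty hAB)
    (fun j p => tagSign p * t + -(taggedRows A B p j).unbotD 0) (taggedRows B A)

theorem coe_add_negBar_add (t a : ℝ) (y : Rmax) :
    ((t : Rmax) : RmaxBar) + (negBar (a : Rmax) + (y : RmaxBar)) =
      ((((t + -a : ℝ) : Rmax) + y : Rmax) : RmaxBar) := by
  rw [WithBot.coe_add, add_assoc]
  rfl

theorem coe_add_residuated_le (A : Matrix (Fin m) (Fin n) Rmax) (t : ℝ) (y : Fin m → Rmax)
    {i : Fin m} {j : Fin n} (h : A i j ≠ ⊥) :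
    ((t : Rmax) : RmaxBar) + residuated A y j ≤
      ((((t + -(A i j).unbotD 0 : ℝ) : Rmax) + y i : Rmax) : RmaxBar) := by
  obtain ⟨a, ha⟩ := WithBot.ne_bot_iff_exists.1 h
  have hle : residuated A y j ≤ negBar (A i j) + (y i : RmaxBar) :=
    Finset.inf_le (Finset.mem_univ i)
  refine (add_le_add_right hle _).trans ?_
  rw [← ha, coe_add_negBar_add, WithBot.unbotD_coe]

theorem le_coe_add_residuated (A : Matrix (Fin m) (Fin n) Rmax) (t : ℝ) (y : Fin m → Rmax)
    {j : Fin n} {v : RmaxBar} (h : ∀ i, A i j ≠ ⊥ →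
      v ≤ ((((t + -(A i j).unbotD 0 : ℝ) : Rmax) + y i : Rmax) : RmaxBar)) :
    v ≤ ((t : Rmax) : RmaxBar) + residuated A y j := by
  rcases Finset.univ.eq_empty_or_nonempty (α := Fin m) with he | hne
  · simp [residuated, he]
  obtain ⟨i, -, hi⟩ := Finset.exists_mem_eq_inf Finset.univ hne
    fun i => negBar (A i j) + (y i : RmaxBar)
  rw [residuated, hi]
  have hv := h i
  induction hA : A i j using WithBot.recBotCoe with
  | bot => simp [negBar]
  | coe a =>
    rw [coe_add_negBar_add]
    simpa [hA] using hv

/-- A `-∞` entry contributes `+∞` to the minimum and can be dropped; `hAB` leaves at least one term.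
-/
theorem minMaxFun_eq_pairGame (hAB : ∀ j, ∃ i, A i j ≠ ⊥ ∨ B i j ≠ ⊥) (t : ℝ)
    (x : Fin n → Rmax) (j : Fin n) :
    minMaxFun A B t x j = (pairGame hAB t x j : RmaxBar) := by
  apply le_antisymm
  · obtain ⟨⟨i, b⟩, hp, h⟩ := exists_gameMap_eq_add_sup (hP := columnSupport_nonempty hAB)
      (c := fun j p => tagSign p * t + -(taggedRows A B p j).unbotD 0) (M := taggedRows B A) x j
    rw [pairGame, h]
    cases b
    · refine inf_le_right.trans ((coe_add_residuated_le B (-t) _ (mem_columnSupport.1 hp)).trans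
        (le_of_eq ?_))
      simp [taggedRows, tagSign, mulVec]
    · refine inf_le_left.trans ((coe_add_residuated_le A t _ (mem_columnSupport.1 hp)).trans
        (le_of_eq ?_))
      simp [taggedRows, tagSign, mulVec]
  · refine le_inf (le_coe_add_residuated A t _ fun i hi => ?_)
      (le_coe_add_residuated B (-t) _ fun i hi => ?_)
    · refine (WithTop.coe_le_coe.2 (gameMap_le
        (mem_columnSupport.2 (show taggedRows A B (i, true) j ≠ ⊥ from hi)))).trans (le_of_eq ?_)
      simp [taggedRows, tagSign, mulVec]
    · refine (WithTop.coe_le_coe.2 (gameMap_le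
        (mem_columnSupport.2 (show taggedRows A B (i, false) j ≠ ⊥ from hi)))).trans (le_of_eq ?_)
      simp [taggedRows, tagSign, mulVec]

theorem spectralFunctionEq_of_isMaximalEigenvalue {hAB : ∀ j, ∃ i, A i j ≠ ⊥ ∨ B i j ≠ ⊥}
    {t μ : ℝ} (h : IsMaximalEigenvalue (pairGame hAB t) μ) : SpectralFunctionEq A B t μ := by
  constructor
  · obtain ⟨x, hx, hg⟩ := h.1
    exact ⟨x, hx, fun j => by rw [minMaxFun_eq_pairGame hAB, hg]⟩
  · rintro ν ⟨x, hx, hν⟩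
    induction ν using WithBot.recBotCoe with
    | bot => exact bot_le
    | coe ν =>
      refine WithBot.coe_le_coe.2 (h.2 ν x hx fun j => ?_)
      have := hν j
      rw [minMaxFun_eq_pairGame hAB] at this
      exact (WithTop.coe_inj.1 this).ge

theorem SpectralFunctionEq.swap {t v : ℝ} (h : SpectralFunctionEq A B t v) :
    SpectralFunctionEq B A (-t) v := by
  have : minMaxFun B A (-t) = minMaxFun A B t := by
    funext x j
    rw [minMaxFun, minMaxFun, neg_neg, inf_comm]
  rwa [SpectralFunctionEq, this]

theorem IsLeftSlope.swap {σ : ℝ} (h : IsLeftSlope A B σ) : IsRightSlope B A (-σ) := by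
  obtain ⟨α, L, h⟩ := h
  refine ⟨α, -L, fun t ht => ?_⟩
  have := (h (-t) (by linarith)).swap
  rwa [neg_neg, neg_mul_comm] at this

theorem IsRightSlope.swap {σ : ℝ} (h : IsRightSlope A B σ) : IsLeftSlope B A (-σ) := by
  obtain ⟨α, L, h⟩ := h
  refine ⟨α, -L, fun t ht => ?_⟩
  have := (h (-t) (by linarith)).swap
  rwa [neg_neg, neg_mul_comm] at this

theorem taggedRows_ne_bot (hA : ∀ i, ∃ j, A i j ≠ ⊥) (hB : ∀ i, ∃ j, B i j ≠ ⊥)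
    (p : Fin m × Bool) : ∃ j, taggedRows A B p j ≠ ⊥ := by
  obtain ⟨i, _ | _⟩ := p
  exacts [hB i, hA i]

theorem exists_pairGame_spectralFunction (hn : 0 < n) (hA : ∀ i, ∃ j, A i j ≠ ⊥)
    (hB : ∀ i, ∃ j, B i j ≠ ⊥) (hAB : ∀ j, ∃ i, A i j ≠ ⊥ ∨ B i j ≠ ⊥) :
    ∃ s : ℝ → ℝ, ∀ t, IsMaximalEigenvalue (pairGame hAB t) (s t) := by
  have : Nonempty (Fin n) := ⟨⟨0, hn⟩⟩
  choose s hs using fun t => exists_isMaximalEigenvalue_gameMap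
    (hP := columnSupport_nonempty hAB)
    (c := fun j p => tagSign p * t + -(taggedRows A B p j).unbotD 0) (taggedRows_ne_bot hB hA)
  exact ⟨s, hs⟩

variable {hAB : ∀ j, ∃ i, A i j ≠ ⊥ ∨ B i j ≠ ⊥}

theorem taggedRows_swap (p : Fin m × Bool) : taggedRows B A p = taggedRows A B (p.1, !p.2) := by
  obtain ⟨i, _ | _⟩ := p <;> rfl

theorem tagSign_not (p : Fin m × Bool) : tagSign (p.1, !p.2) = -tagSign p := by
  obtain ⟨i, _ | _⟩ := p <;> rfl

/-- Residuation gives `μ + A x ≤ t + B x` and `μ + B x ≤ -t + A x`; adding them at a row where `A x`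
or `B x` is finite yields `2 μ ≤ 0`. -/
theorem IsMaximalEigenvalue.pairGame_nonpos {t μ : ℝ}
    (h : IsMaximalEigenvalue (pairGame hAB t) μ) : μ ≤ 0 := by
  obtain ⟨x, ⟨j, hj⟩, hx⟩ := h.1
  have : Nonempty (Fin n) := ⟨j⟩
  set y : Fin m × Bool → Rmax := fun p => Finset.univ.sup fun k => taggedRows A B p k + x k with hy
  have key : ∀ p, (μ : Rmax) + y p ≤ ((tagSign p * t : ℝ) : Rmax) + y (p.1, !p.2) := by
    intro p
    obtain ⟨k, -, hk⟩ := Finset.exists_mem_eq_sup Finset.univ Finset.univ_nonempty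
      fun k => taggedRows A B p k + x k
    rw [hy]
    beta_reduce
    rw [hk]
    by_cases hb : taggedRows A B p k = ⊥
    · simp [hb]
    have h1 := gameMap_le (hP := columnSupport_nonempty hAB)
      (c := fun j p => tagSign p * t + -(taggedRows A B p j).unbotD 0) (M := taggedRows B A)
      (x := x) (mem_columnSupport.2 hb)
    obtain ⟨a, ha⟩ := WithBot.ne_bot_iff_exists.1 hb
    have h2 := (hx k).symm.le.trans h1
    rw [taggedRows_swap (A := A) (B := B) p, ← ha, WithBot.unbotD_coe] at h2
    rw [← ha]
    calc (μ : Rmax) + (a + x k) = a + (μ + x k) := add_left_comm _ _ _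
      _ ≤ _ := add_le_add_right h2 _
      _ = _ := by
        rw [← add_assoc, ← WithBot.coe_add]
        congr 2
        ring
  obtain ⟨p, hp⟩ := columnSupport_nonempty hAB j
  have hyp : y p ≠ ⊥ := ne_bot_of_le_ne_bot
    (WithBot.add_ne_bot.2 ⟨mem_columnSupport.1 hp, hj⟩)
    (Finset.le_sup (f := fun k => taggedRows A B p k + x k) (Finset.mem_univ j))
  have h1 := key p
  have h2 := key (p.1, !p.2)
  rw [tagSign_not, Bool.not_not] at h2
  obtain ⟨r, hr⟩ := WithBot.ne_bot_iff_exists.1 hyp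
  rw [← hr] at h1 h2
  obtain ⟨r', hr'⟩ := WithBot.ne_bot_iff_exists.1 (WithBot.add_ne_bot.1
    (ne_bot_of_le_ne_bot (by rw [← WithBot.coe_add]; exact WithBot.coe_ne_bot) h1)).2
  rw [← hr'] at h1 h2
  have h1 : μ + r ≤ tagSign p * t + r' := by exact_mod_cast h1
  have h2 : μ + r' ≤ ((-tagSign p : ℤ) : ℝ) * t + r := by exact_mod_cast h2
  push_cast at h2
  linarith

theorem pairGame_le_add (hn : 0 < n) (t t' : ℝ) (x : Fin n → Rmax) (j : Fin n) :
    pairGame hAB t x j ≤ (|t - t'| : ℝ) + pairGame hAB t' x j := by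
  have : Nonempty (Fin n) := ⟨⟨0, hn⟩⟩
  refine gameMap_le_add_gameMap (fun j => Finset.Subset.refl _) (fun j p _ k => ?_) x j
  rw [← add_assoc, ← WithBot.coe_add]
  refine add_le_add_left (WithBot.coe_le_coe.2 ?_) _
  have h1 := le_abs_self (t - t')
  have h2 := neg_abs_le (t - t')
  obtain ⟨i, _ | _⟩ := p <;> simp only [tagSign, cond_true, cond_false] <;> push_cast <;> linarith

theorem continuous_spectralFunction (hn : 0 < n) {s : ℝ → ℝ}
    (hs : ∀ t, IsMaximalEigenvalue (pairGame hAB t) (s t)) : Continuous s :=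
  (LipschitzWith.of_le_add fun t t' => by
    have := (hs t).le_add (hs t') (pairGame_le_add hn t t')
    rw [Real.dist_eq]
    linarith : LipschitzWith 1 s).continuous

theorem exists_isRightSlope (hn : 0 < n) (hA : ∀ i, ∃ j, A i j ≠ ⊥)
    (hB : ∀ i, ∃ j, B i j ≠ ⊥) (hAB : ∀ j, ∃ i, A i j ≠ ⊥ ∨ B i j ≠ ⊥) :
    ∃ k l : ℕ, 0 < l ∧ IsRightSlope A B (-((k : ℝ) / l)) := by
  have : Nonempty (Fin n) := ⟨⟨0, hn⟩⟩
  obtain ⟨s, hs⟩ := exists_pairGame_spectralFunction hn hA hB hAB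
  obtain ⟨F, hF, hline⟩ := exists_finset_eigenvalue_eq (columnSupport_nonempty hAB) tagSign
    (fun j p => -(taggedRows A B p j).unbotD 0) (taggedRows B A)
  obtain ⟨q, hq, L, hL⟩ := exists_eventually_eq_line (continuous_spectralFunction hn hs)
    fun t => let ⟨x, hx, hg⟩ := (hs t).1; hline t (s t) x hx hg
  obtain ⟨p, l, hl, hpl⟩ := hF q hq
  have hq0 : q.1 ≤ 0 := by
    by_contra hcon
    push Not at hcon
    -- At this point a line of positive slope has value at least `1`.
    have h := hL (max L ((1 - q.2) / q.1)) (le_max_left _ _)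
    have h0 := (hs (max L ((1 - q.2) / q.1))).pairGame_nonpos
    have h1 := (div_le_iff₀ hcon).1 (le_max_right L ((1 - q.2) / q.1))
    linarith
  have hp : p ≤ 0 := by
    by_contra hcon
    push Not at hcon
    have : (0 : ℝ) < p / l := div_pos (by exact_mod_cast hcon) (by exact_mod_cast hl)
    linarith
  obtain ⟨k, rfl⟩ := Int.exists_eq_neg_ofNat hp
  refine ⟨k, l, hl, q.2, L, fun t ht => ?_⟩
  have := spectralFunctionEq_of_isMaximalEigenvalue (hs t)
  rw [hL t ht, hpl] at this
  convert this using 3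
  push_cast
  ring

end TwoMatrices

/-! ### Comparison with the Boolean patterns -/

section Pattern

variable {m n : ℕ} {A B : Matrix (Fin m) (Fin n) Rmax}

theorem pattern_eq_bot_iff {i : Fin m} {j : Fin n} : pattern A i j = ⊥ ↔ A i j = ⊥ := by
  simp [pattern]

theorem taggedRows_pattern (p : Fin m × Bool) (j : Fin n) :
    taggedRows (pattern A) (pattern B) p j =
      WithBot.map (fun _ : ℝ => (0 : ℝ)) (taggedRows A B p j) := by
  obtain ⟨i, _ | _⟩ := p <;> rfl

theorem columnSupport_pattern (j : Fin n) :
    columnSupport (pattern A) (pattern B) j = columnSupport A B j := by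
  ext p
  simp [mem_columnSupport, taggedRows_pattern]

theorem unbotD_map_const_zero (a : Rmax) : (WithBot.map (fun _ : ℝ => (0 : ℝ)) a).unbotD 0 = 0 := by
  induction a using WithBot.recBotCoe <;> rfl

theorem exists_pairGame_pattern_bounds (hn : 0 < n)
    (hAB : ∀ j, ∃ i, A i j ≠ ⊥ ∨ B i j ≠ ⊥)
    (hAB' : ∀ j, ∃ i, pattern A i j ≠ ⊥ ∨ pattern B i j ≠ ⊥) :
    ∃ D : ℝ, ∀ t x j, pairGame hAB t x j ≤ D + pairGame hAB' t x j ∧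
      pairGame hAB' t x j ≤ D + pairGame hAB t x j := by
  have : Nonempty (Fin n) := ⟨⟨0, hn⟩⟩
  have hbd : ∀ A B : Matrix (Fin m) (Fin n) Rmax,
      ∃ D : ℝ, ∀ p j, |(taggedRows A B p j).unbotD 0| ≤ D := fun A B => by
    obtain ⟨D, hD⟩ := (Set.finite_range fun q : (Fin m × Bool) × Fin n =>
      |(taggedRows A B q.1 q.2).unbotD 0|).bddAbove
    exact ⟨D, fun p j => hD ⟨(p, j), rfl⟩⟩
  obtain ⟨D, hD⟩ := hbd A B
  obtain ⟨D', hD'⟩ := hbd B A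
  refine ⟨D + D', fun t x j => ⟨gameMap_le_add_gameMap
    (fun j => (columnSupport_pattern j).subset) (fun j p _ k => ?_) x j,
    gameMap_le_add_gameMap (fun j => (columnSupport_pattern j).superset)
    (fun j p _ k => ?_) x j⟩⟩
  all_goals
    rw [taggedRows_pattern, taggedRows_pattern, unbotD_map_const_zero]
    have h1 := abs_le.1 (hD p j)
    have h2 := abs_le.1 (hD' p k)
    induction hM : taggedRows B A p k using WithBot.recBotCoe with
    | bot => simp
    | coe a =>
      rw [hM, WithBot.unbotD_coe] at h2
      rw [WithBot.map_coe, ← WithBot.coe_add, ← WithBot.coe_add, ← WithBot.coe_add]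
      exact WithBot.coe_le_coe.2 (by linarith)

theorem map_mul_add {c : ℝ} (a b : Rmax) :
    WithBot.map (c * ·) (a + b) = WithBot.map (c * ·) a + WithBot.map (c * ·) b := by
  induction a using WithBot.recBotCoe with
  | bot => simp
  | coe a =>
    induction b using WithBot.recBotCoe with
    | bot => simp
    | coe b =>
      rw [← WithBot.coe_add, WithBot.map_coe, WithBot.map_coe, WithBot.map_coe,
        ← WithBot.coe_add, mul_add]

theorem monotone_map_mul {c : ℝ} (hc : 0 ≤ c) : Monotone (WithBot.map (c * ·) : Rmax → Rmax) :=
  WithBot.monotone_map_iff.2 fun _ _ h => mul_le_mul_of_nonneg_left h hc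

/-- Pattern entries are `0` or `-∞`, both fixed by multiplication by `c`, which commutes with max,
min and addition. -/
theorem pairGame_pattern_scale {c : ℝ} (hc : 0 ≤ c)
    (hAB : ∀ j, ∃ i, pattern A i j ≠ ⊥ ∨ pattern B i j ≠ ⊥) (t : ℝ) (x : Fin n → Rmax)
    (j : Fin n) : pairGame hAB (c * t) (fun k => WithBot.map (c * ·) (x k)) j =
      WithBot.map (c * ·) (pairGame hAB t x j) := by
  have hsup : ∀ y : Fin n → Rmax, WithBot.map (c * ·) (Finset.univ.sup y) =
      Finset.univ.sup fun k => WithBot.map (c * ·) (y k) := fun y =>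
    Finset.apply_sup_eq_sup_comp _ (fun a b => (monotone_map_mul hc).map_sup a b) rfl
  simp only [pairGame, gameMap]
  rw [Finset.apply_inf'_eq_inf'_comp (columnSupport_nonempty hAB j) _
    (fun a b => (monotone_map_mul hc).map_inf a b)]
  refine Finset.inf'_congr _ rfl fun p _ => ?_
  rw [Function.comp_apply, map_mul_add, hsup, WithBot.map_coe]
  congr 1
  · rw [taggedRows_pattern, unbotD_map_const_zero]
    exact WithBot.coe_inj.2 (by ring)
  · refine Finset.sup_congr rfl fun k _ => ?_
    rw [map_mul_add, taggedRows_pattern, WithBot.map_map]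
    congr 2
    funext
    simp

theorem pattern_spectralFunction_mul {hAB : ∀ j, ∃ i, pattern A i j ≠ ⊥ ∨ pattern B i j ≠ ⊥}
    {s : ℝ → ℝ} (hs : ∀ t, IsMaximalEigenvalue (pairGame hAB t) (s t)) {c : ℝ} (hc : 0 < c)
    (t : ℝ) : s (c * t) = c * s t := by
  have key : ∀ {c : ℝ}, 0 < c → ∀ t, c * s t ≤ s (c * t) := by
    intro c hc t
    obtain ⟨x, ⟨j, hj⟩, hx⟩ := (hs t).1
    refine (hs (c * t)).2 _ (fun k => WithBot.map (c * ·) (x k)) ⟨j, by simpa using hj⟩ ?_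
    intro k
    rw [pairGame_pattern_scale hc.le, hx, map_mul_add, WithBot.map_coe]
  refine le_antisymm ?_ (key hc t)
  have := key (inv_pos.2 hc) (c * t)
  rw [inv_mul_cancel_left₀ hc.ne'] at this
  rwa [inv_mul_le_iff₀ hc] at this

theorem IsRightSlope.pattern_spectralFunctionEq (hn : 0 < n) (hA : ∀ i, ∃ j, A i j ≠ ⊥)
    (hB : ∀ i, ∃ j, B i j ≠ ⊥) (hAB : ∀ j, ∃ i, A i j ≠ ⊥ ∨ B i j ≠ ⊥) {σ : ℝ}
    (h : IsRightSlope A B σ) {t : ℝ} (ht : 0 ≤ t) :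
    SpectralFunctionEq (pattern A) (pattern B) t (t * σ) := by
  have hAB' : ∀ j, ∃ i, pattern A i j ≠ ⊥ ∨ pattern B i j ≠ ⊥ := by
    simpa only [ne_eq, pattern_eq_bot_iff] using hAB
  obtain ⟨s, hs⟩ := exists_pairGame_spectralFunction hn hA hB hAB
  obtain ⟨s', hs'⟩ := exists_pairGame_spectralFunction hn
    (by simpa only [ne_eq, pattern_eq_bot_iff] using hA)
    (by simpa only [ne_eq, pattern_eq_bot_iff] using hB) hAB'
  obtain ⟨D, hD⟩ := exists_pairGame_pattern_bounds hn hAB hAB'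
  obtain ⟨α, L, hL⟩ := h
  have hsL : ∀ u, L ≤ u → s u = u * σ + α := fun u hu =>
    WithBot.coe_inj.1 ((spectralFunctionEq_of_isMaximalEigenvalue (hs u)).unique (hL u hu))
  suffices hst : s' t = t * σ from hst ▸ spectralFunctionEq_of_isMaximalEigenvalue (hs' t)
  rcases ht.eq_or_lt with rfl | ht
  · have := pattern_spectralFunction_mul hs' two_pos 0
    rw [mul_zero] at this
    linarith
  have hbd : ∀ c : ℝ, 0 < c → L / t ≤ c → |c * (s' t - t * σ)| ≤ D + |α| := by
    intro c hc hcL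
    have h1 := (hs (c * t)).le_add (hs' (c * t)) fun x j => (hD (c * t) x j).1
    have h2 := (hs' (c * t)).le_add (hs (c * t)) fun x j => (hD (c * t) x j).2
    rw [hsL _ ((div_le_iff₀ ht).1 hcL), pattern_spectralFunction_mul hs' hc] at h1 h2
    have h3 := le_abs_self α
    have h4 := neg_abs_le α
    rw [abs_le]
    constructor <;> linarith
  by_contra hne
  have hd : 0 < |s' t - t * σ| := abs_pos.2 (sub_ne_zero.2 hne)
  -- Large enough that `c t ≥ L` and that `c |s' t - t σ|` exceeds the uniform bound.
  set c := max (max 1 (L / t)) ((D + |α| + 1) / |s' t - t * σ|) with hc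
  have hc1 : 0 < c := one_pos.trans_le ((le_max_left _ _).trans (le_max_left _ _))
  have h1 := hbd c hc1 ((le_max_right _ _).trans (le_max_left _ _))
  have h2 := (div_le_iff₀ hd).1 (le_max_right (max 1 (L / t)) ((D + |α| + 1) / |s' t - t * σ|))
  rw [abs_mul, abs_of_pos hc1] at h1
  linarith

end Pattern

end TwoSidedEig

/-! ### The theorem, with left slopes obtained by exchanging `A` and `B` -/

open TwoSidedEig in
theorem mainTheorem11 (m n : ℕ) (hn : 0 < n) (A B : Matrix (Fin m) (Fin n) Rmax)
    (hA : ∀ i, ∃ j, A i j ≠ ⊥) (hB : ∀ i, ∃ j, B i j ≠ ⊥)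
    (hAB : ∀ j, ∃ i, A i j ≠ ⊥ ∨ B i j ≠ ⊥) :
    (∃ k₁ l₁ : ℕ, 0 < l₁ ∧ IsLeftSlope A B ((k₁ : ℝ) / l₁)) ∧
    (∃ k₂ l₂ : ℕ, 0 < l₂ ∧ IsRightSlope A B (-((k₂ : ℝ) / l₂))) ∧
    ∀ k₁ l₁ k₂ l₂ : ℕ, 0 < l₁ → 0 < l₂ →
      IsLeftSlope A B ((k₁ : ℝ) / l₁) → IsRightSlope A B (-((k₂ : ℝ) / l₂)) →
      (∀ t : ℝ, t ≤ 0 → SpectralFunctionEq (pattern A) (pattern B) t (t * ((k₁ : ℝ) / l₁))) ∧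
      (∀ t : ℝ, 0 ≤ t → SpectralFunctionEq (pattern A) (pattern B) t (-(t * ((k₂ : ℝ) / l₂)))) := by
  have hBA : ∀ j, ∃ i, B i j ≠ ⊥ ∨ A i j ≠ ⊥ := by simpa only [or_comm] using hAB
  refine ⟨?_, exists_isRightSlope hn hA hB hAB, fun k₁ l₁ k₂ l₂ _ _ hl hr => ⟨fun t ht => ?_,
    fun t ht => ?_⟩⟩
  · obtain ⟨k, l, hl, h⟩ := exists_isRightSlope hn hB hA hBA
    exact ⟨k, l, hl, by simpa only [neg_neg] using h.swap⟩
  · have := (hl.swap.pattern_spectralFunctionEq hn hB hA hBA (neg_nonneg.2 ht)).swap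
    rwa [neg_neg, neg_mul_neg] at this
  · have := hr.pattern_spectralFunctionEq hn hA hB hAB ht
    rwa [mul_neg] at this
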